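/- Let $n\ge 1$, let $B^n$ be the open Euclidean unit ball of $\mathbb C^n$, $\partial B^n$ the unit sphere, and let $C(\partial B^n)$ be the Banach space of continuous functions $\partial B^n\to\mathbb C$ with the supremum norm. Let $\Omega$ be one of the two sides of the sphere: $\Omega=B^n$ (inner side) or $\Omega=\mathbb C^n\setminus\overline{B^n}$ (outer side). A function $f\in C(\partial B^n)$ is holomorphically extendable from the side $\Omega$ at a point $\zeta\in\partial B^n$ if there are an open neighborhood $U$ of $\zeta$ in $\mathbb C^n$ and a continuous function $F:[U\cap\Omega]\cup\partial B^n\to\mathbb C$ that is holomorphic on $U\cap\Omega$ and equals $f$ on $\partial B^n$. It is so extendable in the separately continuous sense if instead of continuity one only requires $F$ to be bounded and separately continuous (continuous in each complex variable $z_i$ on the corresponding slices of $[U\cap\Omega]\cup\partial B^n$, the other variables being fixed), and in the Lipschitz continuous sense if one requires $F$ to be Lipschitz continuous on $[U\cap\Omega]\cup\partial B^n$. Then, for each of the two sides $\Omega$: 1. The set of functions in $C(\partial B^n)$ that are at no point of $\partial B^n$ holomorphically extendable from the side $\Omega$ in the separately continuous sense is a dense $G_\delta$ subset of $C(\partial B^n)$.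 2. The set of functions in $C(\partial B^n)$ that are at no point of $\partial B^n$ holomorphically extendable from the side $\Omega$ (in the usual sense) is residual in $C(\partial B^n)$, i.e. it contains a dense $G_\delta$ subset. 3. The set of functions in $C(\partial B^n)$ that are at no point of $\partial B^n$ holomorphically extendable from the side $\Omega$ in the Lipschitz continuous sense is a dense $G_\delta$ subset of $C(\partial B^n)$. -/

import Mathlib

namespace OneSidedSphere

/-- The unit sphere `∂Bⁿ` of `ℂⁿ` (Euclidean norm). -/
abbrev USphere (n : ℕ) : Set (EuclideanSpace ℂ (Fin n)) :=
  Metric.sphere (0 : EuclideanSpace ℂ (Fin n)) 1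

/-- The inner side of the sphere: the open unit ball `Bⁿ`. -/
def innerSide (n : ℕ) : Set (EuclideanSpace ℂ (Fin n)) :=
  Metric.ball (0 : EuclideanSpace ℂ (Fin n)) 1

/-- The outer side of the sphere: the complement of the closed unit ball. -/
def outerSide (n : ℕ) : Set (EuclideanSpace ℂ (Fin n)) :=
  (Metric.closedBall (0 : EuclideanSpace ℂ (Fin n)) 1)ᶜ

/-- The set `[U ∩ Ω] ∪ ∂Bⁿ` on which an extension from the side `Ω` lives. -/
def extDomain {n : ℕ} (Ω U : Set (EuclideanSpace ℂ (Fin n))) :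
    Set (EuclideanSpace ℂ (Fin n)) :=
  (U ∩ Ω) ∪ USphere n

/-- `F` is holomorphic on `U ∩ Ω` and agrees with `f` on the whole sphere. Only the values of `F`
on `extDomain Ω U` are relevant. -/
def IsHolomorphicExtension {n : ℕ} (Ω U : Set (EuclideanSpace ℂ (Fin n)))
    (F : EuclideanSpace ℂ (Fin n) → ℂ) (f : C(USphere n, ℂ)) : Prop :=
  DifferentiableOn ℂ F (U ∩ Ω) ∧ ∀ x : USphere n, F x = f x

/-- `F` is separately continuous on `A`: whenever all coordinates but the `i`-th are frozen at those
of a point `z ∈ A`, the resulting function of one complex variable is continuous on the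
corresponding slice of `A`. -/
def SeparatelyContinuousOn {n : ℕ} (F : EuclideanSpace ℂ (Fin n) → ℂ)
    (A : Set (EuclideanSpace ℂ (Fin n))) : Prop :=
  ∀ z ∈ A, ∀ i : Fin n,
    ContinuousOn (fun w : ℂ => F (WithLp.toLp 2 (Function.update z.ofLp i w)))
      {w : ℂ | WithLp.toLp 2 (Function.update z.ofLp i w) ∈ A}

/-- One-sided holomorphic extendability at `ζ` (usual sense): the extension is continuous. -/
def ExtendableAt {n : ℕ} (Ω : Set (EuclideanSpace ℂ (Fin n))) (f : C(USphere n, ℂ))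
    (ζ : USphere n) : Prop :=
  ∃ U : Set (EuclideanSpace ℂ (Fin n)), IsOpen U ∧ (ζ : EuclideanSpace ℂ (Fin n)) ∈ U ∧
    ∃ F : EuclideanSpace ℂ (Fin n) → ℂ, IsHolomorphicExtension Ω U F f ∧
      ContinuousOn F (extDomain Ω U)

/-- One-sided holomorphic extendability at `ζ` in the separately continuous sense: the extension
is bounded and separately continuous. -/
def SepExtendableAt {n : ℕ} (Ω : Set (EuclideanSpace ℂ (Fin n))) (f : C(USphere n, ℂ))
    (ζ : USphere n) : Prop :=
  ∃ U : Set (EuclideanSpace ℂ (Fin n)), IsOpen U ∧ (ζ : EuclideanSpace ℂ (Fin n)) ∈ U ∧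
    ∃ F : EuclideanSpace ℂ (Fin n) → ℂ, IsHolomorphicExtension Ω U F f ∧
      (∃ M : ℝ, ∀ z ∈ extDomain Ω U, ‖F z‖ ≤ M) ∧
      SeparatelyContinuousOn F (extDomain Ω U)

/-- One-sided holomorphic extendability at `ζ` in the Lipschitz sense: the extension is Lipschitz
continuous. -/
def LipExtendableAt {n : ℕ} (Ω : Set (EuclideanSpace ℂ (Fin n))) (f : C(USphere n, ℂ))
    (ζ : USphere n) : Prop :=
  ∃ U : Set (EuclideanSpace ℂ (Fin n)), IsOpen U ∧ (ζ : EuclideanSpace ℂ (Fin n)) ∈ U ∧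
    ∃ F : EuclideanSpace ℂ (Fin n) → ℂ, IsHolomorphicExtension Ω U F f ∧
      ∃ K : NNReal, LipschitzOnWith K F (extDomain Ω U)

/-- Functions in `C(∂Bⁿ)` that are extendable from the side `Ω` at no point (usual sense). -/
def nowhereExtendable {n : ℕ} (Ω : Set (EuclideanSpace ℂ (Fin n))) : Set C(USphere n, ℂ) :=
  {f | ∀ ζ : USphere n, ¬ ExtendableAt Ω f ζ}

/-- Functions in `C(∂Bⁿ)` that are extendable from the side `Ω` at no point, in the separately
continuous sense. -/
def nowhereSepExtendable {n : ℕ} (Ω : Set (EuclideanSpace ℂ (Fin n))) : Set C(USphere n, ℂ) :=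
  {f | ∀ ζ : USphere n, ¬ SepExtendableAt Ω f ζ}

/-- Functions in `C(∂Bⁿ)` that are extendable from the side `Ω` at no point, in the Lipschitz
sense. -/
def nowhereLipExtendable {n : ℕ} (Ω : Set (EuclideanSpace ℂ (Fin n))) : Set C(USphere n, ℂ) :=
  {f | ∀ ζ : USphere n, ¬ LipExtendableAt Ω f ζ}

end OneSidedSphere

/-! The separately continuous case is a Baire category argument. For a ball around a sphere point
and a bound `M`, consider the functions having an extension over that ball which is bounded by `M`.
The crux is `sepExtendableOn_of_mem_closure`: a uniform limit of such functions is extendable over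
every smaller concentric ball, with the same bound. Hence if the closure had interior, so would the
linear subspace of functions with some bounded extension over the half-radius ball; that subspace
would be all of C(∂Bⁿ), which `exists_not_sepExtendableOn` refutes. Countably many balls and integer
bounds suffice, so Baire gives a dense Gδ.

For the crux, the extensions are merely bounded, so their pointwise limit is taken along an
ultrafilter. Holomorphy survives by Cauchy estimates (`differentiableOn_of_tendsto_ultrafilter`).
For separate continuity at the sphere, write zᵢ = pᵢ exp(iσt) in the slice through p: the sphere
becomes the real line and Ω the upper half plane. There the two-constants estimate
`exists_norm_le_of_halfDisc` turns uniform convergence on the diameter into uniform convergence on a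
smaller half disc.

A continuous extension is bounded and separately continuous after shrinking U, and Lipschitz
extensions are continuous, so residuality and density in the other two cases follow from the first.
The Lipschitz Gδ property is direct, since a fixed Lipschitz constant passes to pointwise limits. -/

namespace OneSidedSphere

open Filter Topology Set Metric

/-! ### One variable: estimates and uniqueness on a half disc -/

section

/-- A two-constants estimate: a bounded holomorphic function on a half disc which is small on the
real diameter is small on a concentric smaller half disc. -/
theorem exists_norm_le_of_halfDisc {δ : ℝ} (hδ : 0 < δ) (M : ℝ) {η : ℝ} (hη : 0 < η) :
    ∃ ε : ℝ, 0 < ε ∧ ∀ h : ℂ → ℂ,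
      ContinuousOn h {t | ‖t‖ ≤ δ ∧ 0 ≤ t.im} → DifferentiableOn ℂ h {t | ‖t‖ < δ ∧ 0 < t.im} →
      (∀ t : ℂ, ‖t‖ ≤ δ → 0 ≤ t.im → ‖h t‖ ≤ M) →
      (∀ t : ℂ, ‖t‖ ≤ δ → t.im = 0 → ‖h t‖ ≤ ε) →
      ∀ t : ℂ, ‖t‖ ≤ δ / 16 → 0 ≤ t.im → ‖h t‖ ≤ η := by
  set x : ℝ := |M| / η
  have hx : 0 ≤ x := by positivity
  have hMx : |M| ≤ η * Real.exp x := by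
    have : |M| = η * x := by simp only [x]; field_simp
    rw [this]
    have := Real.add_one_le_exp x
    gcongr; linarith
  refine ⟨η / Real.exp x, by positivity, fun h hc hd hM hε t ht htim ↦ ?_⟩
  -- The weight `exp q` has modulus at most 1 on the diameter, at most `exp (-2x)` on the circular
  -- arc, and at least `exp (-x)` on the half disc of radius `δ / 16`. As `|M| ≤ η exp x`, the
  -- maximum principle bounds the weighted function by `η exp (-x)`, and dividing by the weight
  -- leaves `η`.
  set lam : ℝ := 2 * x / δ ^ 2
  have hlam : 0 ≤ lam := by positivity
  have hlx : lam * δ ^ 2 = 2 * x := by simp only [lam]; field_simp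
  let q : ℂ → ℂ := fun t ↦ (lam : ℂ) * (-t ^ 2 + 4 * δ * Complex.I * t)
  have hq : ∀ t : ℂ, (q t).re = lam * (-t.re ^ 2 + t.im ^ 2 - 4 * δ * t.im) := by
    intro t
    simp only [q, pow_two, Complex.mul_re, Complex.add_re, Complex.neg_re, Complex.mul_im,
      Complex.add_im, Complex.neg_im, Complex.ofReal_re, Complex.ofReal_im, Complex.I_re,
      Complex.I_im, Complex.re_ofNat, Complex.im_ofNat]
    ring
  let U : Set ℂ := {t | ‖t‖ < δ ∧ 0 < t.im}
  have hUo : IsOpen U :=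
    (isOpen_lt continuous_norm continuous_const).inter
      (isOpen_lt continuous_const Complex.continuous_im)
  have hcl : closure U ⊆ {t | ‖t‖ ≤ δ ∧ 0 ≤ t.im} :=
    closure_minimal (fun t ht ↦ ⟨ht.1.le, ht.2.le⟩)
      ((isClosed_le continuous_norm continuous_const).inter
        (isClosed_le continuous_const Complex.continuous_im))
  have hU : Bornology.IsBounded U :=
    isBounded_ball.subset (s := U) (t := ball 0 δ) fun t ht ↦ by simpa using ht.1
  have hqd : Differentiable ℂ q := by fun_prop
  have hdc : DiffContOnCl ℂ (fun t ↦ h t * Complex.exp (q t)) U :=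
    ⟨hd.mul hqd.cexp.differentiableOn, (hc.mono hcl).mul hqd.cexp.continuous.continuousOn⟩
  have key : ∀ t ∈ closure U, ‖h t * Complex.exp (q t)‖ ≤ η / Real.exp x := by
    intro t ht
    refine Complex.norm_le_of_forall_mem_frontier_norm_le hU hdc ?_ ht
    intro t ht
    rw [hUo.frontier_eq] at ht
    have htc := hcl ht.1
    rw [norm_mul, Complex.norm_exp, hq]
    have hsq : t.re ^ 2 + t.im ^ 2 = ‖t‖ ^ 2 := by
      rw [Complex.sq_norm, Complex.normSq_apply]; ring
    rcases htc.2.eq_or_lt with h0 | h0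
    · rw [← h0]
      have h1 : lam * (-t.re ^ 2 + 0 ^ 2 - 4 * δ * 0) ≤ 0 := by nlinarith [sq_nonneg t.re]
      calc _ ≤ η / Real.exp x * 1 := by
            gcongr
            · exact hε t htc.1 h0.symm
            · exact Real.exp_le_one_iff.2 h1
        _ = _ := mul_one _
    · have hn : ‖t‖ = δ := by
        by_contra hne
        exact ht.2 ⟨lt_of_le_of_ne htc.1 hne, h0⟩
      have him : t.im ≤ δ := (Complex.abs_im_le_norm t).trans' (le_abs_self _) |>.trans htc.1
      have h1 : lam * (-t.re ^ 2 + t.im ^ 2 - 4 * δ * t.im) ≤ - (2 * x) := by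
        rw [← hlx, ← mul_neg]
        refine mul_le_mul_of_nonneg_left ?_ hlam
        rw [hn] at hsq
        nlinarith
      calc _ ≤ (η * Real.exp x) * Real.exp (-(2 * x)) := by
            gcongr
            exact (hM t htc.1 htc.2).trans ((le_abs_self M).trans hMx)
        _ = η / Real.exp x := by
            rw [div_eq_mul_inv, ← Real.exp_neg, mul_assoc, ← Real.exp_add]; ring_nf
  have hfin : ∀ t : ℂ, ‖t‖ ≤ δ → 0 ≤ t.im → ‖t‖ ≤ δ / 16 → t ∈ closure U → ‖h t‖ ≤ η := by
    intro t _ _ hts htU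
    have h2 := key t htU
    rw [norm_mul, Complex.norm_exp, hq] at h2
    have hre : t.re ^ 2 ≤ (δ / 16) ^ 2 := by
      rw [sq_le_sq, abs_of_pos (by positivity : 0 < δ / 16)]
      exact (Complex.abs_re_le_norm t).trans hts
    have him : t.im ≤ δ / 16 := (Complex.abs_im_le_norm t).trans' (le_abs_self _) |>.trans hts
    have h3 : -x ≤ lam * (-t.re ^ 2 + t.im ^ 2 - 4 * δ * t.im) := by
      have : -x = lam * (-(δ ^ 2 / 2)) := by linarith
      rw [this]
      refine mul_le_mul_of_nonneg_left ?_ hlam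
      nlinarith [sq_nonneg t.im]
    have h4 : ‖h t‖ * Real.exp (-x) ≤ η / Real.exp x :=
      le_trans (by gcongr) h2
    rw [Real.exp_neg, ← div_eq_mul_inv] at h4
    exact (div_le_div_iff_of_pos_right (Real.exp_pos x)).1 h4
  have htδ : ‖t‖ ≤ δ := by linarith
  rcases htim.eq_or_lt with h0 | h0
  · refine (hε t htδ h0.symm).trans (div_le_self hη.le (Real.one_le_exp hx))
  · exact hfin t htδ htim ht (subset_closure ⟨by linarith, h0⟩)

/-- Uniqueness: a function that is holomorphic in a half disc, continuous up to the diameter, and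
zero on the left half of the diameter vanishes on the whole diameter. -/
theorem eq_zero_of_halfDisc {δ : ℝ} (hδ : 0 < δ) {h : ℂ → ℂ}
    (hc : ContinuousOn h {t | ‖t‖ ≤ δ ∧ 0 ≤ t.im})
    (hd : DifferentiableOn ℂ h {t | ‖t‖ < δ ∧ 0 < t.im})
    (h0 : ∀ s : ℝ, |s| ≤ δ → s ≤ 0 → h s = 0) (s : ℝ) (hs : |s| < δ) : h s = 0 := by
  -- The half disc of radius `δ / 2` about `a` has its diameter inside the left half, where `h` is
  -- zero. The two-constants estimate, with arbitrarily small `η`, kills `h` near `a`; the identity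
  -- theorem and continuity do the rest.
  let a : ℂ := ((-(δ / 2) : ℝ) : ℂ)
  have ha : ‖a‖ = δ / 2 := by
    simp only [a]; rw [Complex.norm_real, Real.norm_eq_abs, abs_neg, abs_of_pos (by positivity)]
  have haim : a.im = 0 := by simp [a]
  let K : Set ℂ := {t | ‖t‖ ≤ δ ∧ 0 ≤ t.im}
  let V : Set ℂ := {t | ‖t‖ < δ ∧ 0 < t.im}
  have hK : IsCompact K := (isCompact_closedBall (0 : ℂ) δ).of_isClosed_subset
      ((isClosed_le continuous_norm continuous_const).inter
        (isClosed_le continuous_const Complex.continuous_im)) fun t ht ↦ by simpa using ht.1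
  have hVo : IsOpen V := (isOpen_lt continuous_norm continuous_const).inter
      (isOpen_lt continuous_const Complex.continuous_im)
  have hVc : Convex ℝ V := by
    have h1 : Convex ℝ (ball (0 : ℂ) δ) := convex_ball _ _
    have h2 : Convex ℝ {t : ℂ | 0 < t.im} := convex_halfSpace_im_gt 0
    convert h1.inter h2 using 1
    ext t; simp [V]
  obtain ⟨M, hM⟩ := hK.exists_bound_of_continuousOn hc
  have hadd : ∀ t : ℂ, ‖t‖ ≤ δ / 2 → ‖a + t‖ ≤ δ := fun t ht ↦
    (norm_add_le _ _).trans (by linarith)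
  have hzero : ∀ t : ℂ, ‖t‖ ≤ δ / 2 / 16 → 0 ≤ t.im → h (a + t) = 0 := by
    intro t ht htim
    by_contra hne
    have hpos : 0 < ‖h (a + t)‖ := norm_pos_iff.2 hne
    obtain ⟨ε, hε, H⟩ := exists_norm_le_of_halfDisc (half_pos hδ) M (half_pos hpos)
    have := H (fun t ↦ h (a + t)) ?_ ?_ ?_ ?_ t ht htim
    · linarith
    · refine hc.comp (by fun_prop) fun t ht ↦ ⟨hadd t ht.1, ?_⟩
      simpa [haim] using ht.2
    · refine hd.comp (by fun_prop) fun t ht ↦ ⟨?_, ?_⟩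
      · exact (norm_add_le _ _).trans_lt (by linarith [ht.1])
      · simpa [haim] using ht.2
    · intro t ht htim
      exact hM _ ⟨hadd t ht, by simpa [haim] using htim⟩
    · intro t ht htim
      have hreal : a + t = ((-(δ / 2) + t.re : ℝ) : ℂ) := by
        apply Complex.ext <;> simp [a, htim]
      have hn := hadd t ht
      have hre := (Complex.abs_re_le_norm t).trans ht
      rw [abs_le] at hre
      rw [hreal] at hn ⊢
      rw [Complex.norm_real] at hn
      rw [h0 _ hn (by linarith), norm_zero]
      exact hε.le
  have hEq : EqOn h 0 V := by
    let b : ℂ := a + Complex.I * ((δ / 64 : ℝ) : ℂ)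
    have hI : ‖Complex.I * ((δ / 64 : ℝ) : ℂ)‖ = δ / 64 := by
      rw [norm_mul, Complex.norm_I, one_mul, Complex.norm_real, Real.norm_eq_abs,
        abs_of_pos (by positivity)]
    have hbV : b ∈ V := by
      refine ⟨(norm_add_le _ _).trans_lt (by rw [ha, hI]; linarith), ?_⟩
      simp [b, haim]; positivity
    refine (hd.analyticOnNhd hVo).eqOn_zero_of_preconnected_of_eventuallyEq_zero
      hVc.isPreconnected hbV ?_
    have hW : {t : ℂ | ‖t - a‖ < δ / 2 / 16 ∧ 0 < t.im} ∈ 𝓝 b := by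
      refine IsOpen.mem_nhds ?_ ?_
      · exact (isOpen_lt (continuous_id.sub continuous_const).norm continuous_const).inter
          (isOpen_lt continuous_const Complex.continuous_im)
      · refine ⟨?_, hbV.2⟩
        simp only [b, add_sub_cancel_left]
        rw [hI]; linarith
    filter_upwards [hW] with t ht
    have := hzero (t - a) ht.1.le (by simpa [haim] using ht.2.le)
    simpa using this
  have hsK : (s : ℂ) ∈ K := ⟨by simpa using hs.le, by simp⟩
  have hcl : (s : ℂ) ∈ closure V := by
    have hten : Tendsto (fun y : ℝ ↦ (s : ℂ) + Complex.I * y) (𝓝[>] 0) (𝓝 (s : ℂ)) := by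
      have : Continuous (fun y : ℝ ↦ (s : ℂ) + Complex.I * y) := by fun_prop
      have h2 := (this.tendsto 0).mono_left (nhdsWithin_le_nhds (s := Ioi 0))
      simpa using h2
    refine mem_closure_of_tendsto hten ?_
    have h1 : ∀ᶠ y : ℝ in 𝓝[>] 0, ‖(s : ℂ) + Complex.I * y‖ < δ :=
      hten.norm.eventually_lt_const (by simpa using hs)
    filter_upwards [h1, self_mem_nhdsWithin] with y hy hy0
    exact ⟨hy, by simpa using hy0⟩
  have hVK : V ⊆ K := fun t ht ↦ ⟨ht.1.le, ht.2.le⟩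
  have hw : ContinuousWithinAt h V s := (hc _ hsK).mono hVK
  have : (𝓝[V] (s : ℂ)).NeBot := mem_closure_iff_nhdsWithin_neBot.1 hcl
  refine tendsto_nhds_unique hw (tendsto_const_nhds.congr' ?_)
  filter_upwards [self_mem_nhdsWithin] with t ht using (hEq ht).symm

/-! ### Ultrafilter limits of bounded holomorphic functions -/

variable {ι E : Type*} [NormedAddCommGroup E] [NormedSpace ℂ E]

/-- Cauchy's estimate, then the Schwarz lemma for `f` minus its first-order Taylor polynomial, which
is bounded by `4 * M` and vanishes to second order at `c`. The constants depend only on `M` and `r`,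
so they survive pointwise limits. -/
theorem norm_sub_sub_fderiv_le {f : E → ℂ} {c z : E} {r M : ℝ} (hr : 0 < r)
    (hd : DifferentiableOn ℂ f (ball c r)) (hM : ∀ w ∈ ball c r, ‖f w‖ ≤ M) (hz : z ∈ ball c r) :
    ‖fderiv ℂ f c‖ ≤ 2 * M / r ∧
      ‖f z - f c - fderiv ℂ f c (z - c)‖ ≤ 4 * M / r ^ 2 * ‖z - c‖ ^ 2 := by
  have hc : c ∈ ball c r := mem_ball_self hr
  have hM0 : 0 ≤ M := (norm_nonneg _).trans (hM c hc)
  have h1 : ‖fderiv ℂ f c‖ ≤ 2 * M / r := by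
    refine Complex.norm_fderiv_le_div_of_mapsTo_ball hd (fun w hw ↦ ?_) hr
    rw [mem_closedBall, dist_eq_norm]
    exact (norm_sub_le _ _).trans (by linarith [hM w hw, hM c hc])
  refine ⟨h1, ?_⟩
  let k : E → ℂ := fun w ↦ f w - f c - fderiv ℂ f c (w - c)
  have hk : DifferentiableOn ℂ k (ball c r) := by
    refine (hd.sub_const _).sub ?_
    exact ((fderiv ℂ f c).differentiable.comp (differentiable_id.sub_const c)).differentiableOn
  have hkc : k c = 0 := by simp [k]
  have hfd : HasFDerivAt f (fderiv ℂ f c) c :=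
    (hd.differentiableAt (ball_mem_nhds c hr)).hasFDerivAt
  have := Complex.dist_le_mul_div_pow_of_mapsTo_ball_of_isLittleO (n := 1) (R₂ := 4 * M) hk
    (fun w hw ↦ ?_) ?_ hz
  · rw [hkc, dist_zero_right, dist_eq_norm] at this
    refine this.trans_eq ?_
    rw [div_pow]; ring
  · rw [hkc, mem_closedBall, dist_zero_right]
    have hw' : ‖w - c‖ < r := by simpa [dist_eq_norm] using hw
    have h2 : ‖fderiv ℂ f c (w - c)‖ ≤ 2 * M := by
      refine (ContinuousLinearMap.le_opNorm _ _).trans ?_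
      calc _ ≤ 2 * M / r * r := by gcongr
        _ = _ := by field_simp
    calc ‖k w‖ ≤ ‖f w‖ + ‖f c‖ + ‖fderiv ℂ f c (w - c)‖ :=
          (norm_sub_le _ _).trans (by gcongr; exact norm_sub_le _ _)
      _ ≤ 4 * M := by linarith [hM w hw, hM c hc]
  · simp only [hkc, sub_zero, pow_one]
    exact hfd.isLittleO.norm_right

/-- A pointwise ultrafilter limit of uniformly bounded holomorphic functions is holomorphic. -/
theorem differentiableOn_of_tendsto_ultrafilter [FiniteDimensional ℂ E] (𝒰 : Ultrafilter ι)
    {F : ι → E → ℂ} {G : E → ℂ} {V : Set E} (hV : IsOpen V) {M : ℝ}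
    (hd : ∀ᶠ g in (𝒰 : Filter ι), DifferentiableOn ℂ (F g) V)
    (hM : ∀ᶠ g in (𝒰 : Filter ι), ∀ z ∈ V, ‖F g z‖ ≤ M)
    (hG : ∀ z ∈ V, Tendsto (fun g ↦ F g z) 𝒰 (𝓝 (G z))) : DifferentiableOn ℂ G V := by
  intro c hc
  obtain ⟨r, hr, hrV⟩ := Metric.isOpen_iff.1 hV c hc
  -- Finite dimension makes bounded sets of derivatives relatively compact; the ultrafilter limit
  -- `A` of the derivatives is the derivative of `G`.
  have : FiniteDimensional ℂ (E →L[ℂ] ℂ) := inferInstance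
  have : ProperSpace (E →L[ℂ] ℂ) := FiniteDimensional.proper ℂ _
  have hb : ∀ᶠ g in (𝒰 : Filter ι), fderiv ℂ (F g) c ∈ closedBall (0 : E →L[ℂ] ℂ) (2 * M / r) := by
    filter_upwards [hd, hM] with g hd hM
    rw [mem_closedBall, dist_zero_right]
    exact (norm_sub_sub_fderiv_le hr (hd.mono hrV) (fun w hw ↦ hM w (hrV hw))
      (mem_ball_self hr)).1
  obtain ⟨A, -, hA⟩ := (isCompact_closedBall (0 : E →L[ℂ] ℂ) (2 * M / r)).ultrafilter_le_nhds
    (𝒰.map fun g ↦ fderiv ℂ (F g) c) (le_principal_iff.2 hb)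
  have hA : Tendsto (fun g ↦ fderiv ℂ (F g) c) 𝒰 (𝓝 A) := hA
  have hq : ∀ z ∈ ball c r, ‖G z - G c - A (z - c)‖ ≤ 4 * M / r ^ 2 * ‖z - c‖ ^ 2 := by
    intro z hz
    have hAz : Tendsto (fun g ↦ fderiv ℂ (F g) c (z - c)) 𝒰 (𝓝 (A (z - c))) :=
      ((ContinuousLinearMap.apply ℂ ℂ (z - c)).continuous.tendsto A).comp hA
    refine le_of_tendsto (((hG z (hrV hz)).sub (hG c hc)).sub hAz).norm ?_
    filter_upwards [hd, hM] with g hd hM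
    exact (norm_sub_sub_fderiv_le hr (hd.mono hrV) (fun w hw ↦ hM w (hrV hw)) hz).2
  have hlo : HasFDerivAt G A c := by
    refine .of_isLittleO ?_
    have h1 : (fun z ↦ G z - G c - A (z - c)) =O[𝓝 c] fun z ↦ ‖z - c‖ ^ 2 := by
      refine Asymptotics.IsBigO.of_bound (4 * M / r ^ 2) ?_
      filter_upwards [ball_mem_nhds c hr] with z hz
      simpa using hq z hz
    refine h1.trans_isLittleO ?_
    have h2 : (fun z : E ↦ ‖z - c‖ ^ 2) =o[𝓝 c] fun z ↦ ‖z - c‖ ^ 1 :=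
      (Asymptotics.isLittleO_pow_pow one_lt_two).comp_tendsto
        (by simpa using ((continuous_id.sub continuous_const).norm.tendsto c : Tendsto
          (fun z : E ↦ ‖z - c‖) (𝓝 c) _))
    simpa using h2.norm_right
  exact hlo.differentiableAt.differentiableWithinAt

/-- Ultrafilter limits of bounded holomorphic functions on a half disc are locally uniform up to
the diameter if the boundary values are uniformly Cauchy. -/
theorem eventually_norm_sub_le_of_halfDisc (𝒰 : Ultrafilter ι) {h : ι → ℂ → ℂ} {H : ℂ → ℂ}
    {δ M : ℝ} (hδ : 0 < δ)
    (hc : ∀ᶠ g in (𝒰 : Filter ι), ContinuousOn (h g) {t | ‖t‖ ≤ δ ∧ 0 ≤ t.im})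
    (hd : ∀ᶠ g in (𝒰 : Filter ι), DifferentiableOn ℂ (h g) {t | ‖t‖ < δ ∧ 0 < t.im})
    (hM : ∀ᶠ g in (𝒰 : Filter ι), ∀ t : ℂ, ‖t‖ ≤ δ → 0 ≤ t.im → ‖h g t‖ ≤ M)
    (hb : ∀ ε > 0, ∀ᶠ g in (𝒰 : Filter ι), ∀ᶠ g' in (𝒰 : Filter ι),
      ∀ t : ℂ, ‖t‖ ≤ δ → t.im = 0 → ‖h g t - h g' t‖ ≤ ε)
    (hH : ∀ t : ℂ, ‖t‖ ≤ δ → 0 ≤ t.im → Tendsto (fun g ↦ h g t) 𝒰 (𝓝 (H t)))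
    {η : ℝ} (hη : 0 < η) :
    ∀ᶠ g in (𝒰 : Filter ι), ∀ t : ℂ, ‖t‖ ≤ δ / 16 → 0 ≤ t.im → ‖h g t - H t‖ ≤ η := by
  obtain ⟨ε, hε, key⟩ := exists_norm_le_of_halfDisc hδ (M + M) hη
  filter_upwards [hc, hd, hM, hb ε hε] with g hcg hdg hMg hbg t ht htim
  -- With `g` and `t` fixed, only `g'` runs to the limit; the bound for `h g - h g'` is uniform in
  -- `t`.
  refine le_of_tendsto (tendsto_const_nhds.sub (hH t (by linarith) htim)).norm ?_
  filter_upwards [hc, hd, hM, hbg] with g' hcg' hdg' hMg' hbg'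
  exact key _ (hcg.sub hcg') (hdg.sub hdg')
    (fun t ht htim ↦ (norm_sub_le _ _).trans (add_le_add (hMg t ht htim) (hMg' t ht htim)))
    hbg' t ht htim

end

/-! ### Coordinate slices of the sphere and their half-plane parametrization -/

section

variable {n : ℕ}

/-- The point `p` with its `i`-th coordinate replaced by `w`. -/
def slice (p : EuclideanSpace ℂ (Fin n)) (i : Fin n) (w : ℂ) : EuclideanSpace ℂ (Fin n) :=
  WithLp.toLp 2 (Function.update p.ofLp i w)

theorem slice_self (p : EuclideanSpace ℂ (Fin n)) (i : Fin n) : slice p i (p i) = p := by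
  simp [slice]

theorem slice_apply (p : EuclideanSpace ℂ (Fin n)) (i : Fin n) (w : ℂ) : slice p i w i = w := by
  simp [slice]

theorem slice_slice (p : EuclideanSpace ℂ (Fin n)) (i : Fin n) (w w' : ℂ) :
    slice (slice p i w) i w' = slice p i w' := by
  simp [slice]

theorem slice_eq_add (p : EuclideanSpace ℂ (Fin n)) (i : Fin n) (w : ℂ) :
    slice p i w = p + (w - p i) • EuclideanSpace.single i (1 : ℂ) := by
  ext j
  rcases eq_or_ne j i with rfl | h
  · simp [slice]
  · simp [slice, h]

theorem differentiable_slice (p : EuclideanSpace ℂ (Fin n)) (i : Fin n) :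
    Differentiable ℂ (slice p i) := by
  have : slice p i = fun w ↦ p + (w - p i) • EuclideanSpace.single i (1 : ℂ) :=
    funext (slice_eq_add p i)
  rw [this]
  fun_prop

/-- For `p` on the sphere, this reduces the position of a slice point relative to the sphere to
comparing `‖w‖` with `‖p i‖`. -/
theorem norm_slice_sq (p : EuclideanSpace ℂ (Fin n)) (i : Fin n) (w : ℂ) :
    ‖slice p i w‖ ^ 2 = ‖p‖ ^ 2 - ‖p i‖ ^ 2 + ‖w‖ ^ 2 := by
  rw [EuclideanSpace.norm_sq_eq, EuclideanSpace.norm_sq_eq,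
    ← Finset.add_sum_erase _ (fun j ↦ ‖slice p i w j‖ ^ 2) (Finset.mem_univ i),
    ← Finset.add_sum_erase _ (fun j ↦ ‖p j‖ ^ 2) (Finset.mem_univ i), slice_apply]
  have : ∑ j ∈ Finset.univ.erase i, ‖slice p i w j‖ ^ 2 =
      ∑ j ∈ Finset.univ.erase i, ‖p j‖ ^ 2 := by
    refine Finset.sum_congr rfl fun j hj ↦ ?_
    simp [slice, Finset.ne_of_mem_erase hj]
  rw [this]; ring

/-- `Ω` is a side of the sphere, the sign `σ` being `1` for the inner and `-1` for the outer
side. -/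
def IsSide (σ : ℝ) (Ω : Set (EuclideanSpace ℂ (Fin n))) : Prop :=
  (σ = 1 ∧ Ω = innerSide n) ∨ (σ = -1 ∧ Ω = outerSide n)

variable {σ : ℝ} {Ω U : Set (EuclideanSpace ℂ (Fin n))} {p : EuclideanSpace ℂ (Fin n)} {i : Fin n}

theorem IsSide.isOpen (h : IsSide σ Ω) : IsOpen Ω := by
  rcases h with ⟨-, rfl⟩ | ⟨-, rfl⟩
  · exact isOpen_ball
  · exact isClosed_closedBall.isOpen_compl

theorem IsSide.isClosed_union (h : IsSide σ Ω) : IsClosed (Ω ∪ USphere n) := by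
  rcases h with ⟨-, rfl⟩ | ⟨-, rfl⟩
  · rw [innerSide, ball_union_sphere]; exact isClosed_closedBall
  · have : outerSide n ∪ USphere n = (ball 0 1)ᶜ := by
      ext z; simp [outerSide, le_iff_lt_or_eq, eq_comm]; tauto
    rw [this]; exact isOpen_ball.isClosed_compl

theorem IsSide.sq (h : IsSide σ Ω) : σ * σ = 1 := by
  rcases h with ⟨rfl, -⟩ | ⟨rfl, -⟩ <;> norm_num

theorem slice_mem_sphere (hp : p ∈ USphere n) (w : ℂ) :
    slice p i w ∈ USphere n ↔ ‖w‖ = ‖p i‖ := by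
  have h := norm_slice_sq p i w
  rw [mem_sphere_zero_iff_norm] at hp ⊢
  rw [hp] at h
  rw [← sq_eq_sq₀ (norm_nonneg _) (norm_nonneg (p i)), ← sq_eq_sq₀ (norm_nonneg _) zero_le_one, h]
  constructor <;> intro h <;> linarith

theorem slice_mem_side (hΩ : IsSide σ Ω) (hp : p ∈ USphere n) (w : ℂ) :
    slice p i w ∈ Ω ↔ σ * ‖w‖ < σ * ‖p i‖ := by
  have h := norm_slice_sq p i w
  rw [mem_sphere_zero_iff_norm] at hp
  rw [hp] at h
  rcases hΩ with ⟨rfl, rfl⟩ | ⟨rfl, rfl⟩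
  · rw [innerSide, mem_ball_zero_iff, one_mul, one_mul,
      ← sq_lt_sq₀ (norm_nonneg _) (norm_nonneg (p i)), ← sq_lt_sq₀ (norm_nonneg _) zero_le_one, h]
    constructor <;> intro h <;> linarith
  · rw [outerSide, mem_compl_iff, mem_closedBall_zero_iff, not_le, neg_one_mul, neg_one_mul,
      neg_lt_neg_iff,
      ← sq_lt_sq₀ (norm_nonneg _) (norm_nonneg w), ← sq_lt_sq₀ zero_le_one (norm_nonneg _), h]
    constructor <;> intro h <;> linarith

/-- The slice through `p` in the `i`-th direction in a logarithmic coordinate: real parameters give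
points of the sphere, parameters in the upper half plane points of the side with sign `σ`. -/
noncomputable def arc (σ : ℝ) (p : EuclideanSpace ℂ (Fin n)) (i : Fin n) (t : ℂ) :
    EuclideanSpace ℂ (Fin n) :=
  slice p i (p i * Complex.exp (σ * Complex.I * t))

theorem norm_coord_arc (σ : ℝ) (c t : ℂ) :
    ‖c * Complex.exp (σ * Complex.I * t)‖ = ‖c‖ * Real.exp (-(σ * t.im)) := by
  rw [norm_mul, Complex.norm_exp]
  simp

theorem arc_mem_sphere (hp : p ∈ USphere n) {t : ℂ} (ht : t.im = 0) :
    arc σ p i t ∈ USphere n := by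
  rw [arc, slice_mem_sphere hp, norm_coord_arc, ht]; simp

theorem arc_mem_side (hΩ : IsSide σ Ω) (hp : p ∈ USphere n) (hpi : p i ≠ 0) {t : ℂ} :
    arc σ p i t ∈ Ω ↔ 0 < t.im := by
  have hpos : 0 < ‖p i‖ := norm_pos_iff.2 hpi
  rw [arc, slice_mem_side hΩ hp, norm_coord_arc]
  rcases hΩ with ⟨rfl, -⟩ | ⟨rfl, -⟩
  · simp [hpos]
  · simp [hpos]

theorem im_nonneg_of_arc_mem (hΩ : IsSide σ Ω) (hp : p ∈ USphere n) (hpi : p i ≠ 0) {t : ℂ}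
    (h : arc σ p i t ∈ extDomain Ω U) : 0 ≤ t.im := by
  rcases h with h | h
  · exact ((arc_mem_side hΩ hp hpi).1 h.2).le
  · have hσ := hΩ.sq
    rw [arc, slice_mem_sphere hp, norm_coord_arc] at h
    have h1 : Real.exp (-(σ * t.im)) = 1 :=
      mul_left_cancel₀ (norm_ne_zero_iff.2 hpi) (by rw [h, mul_one])
    rw [Real.exp_eq_one_iff, neg_eq_zero] at h1
    rcases mul_eq_zero.1 h1 with h2 | h2
    · rw [h2] at hσ; norm_num at hσ
    · exact h2.ge

theorem differentiable_arc (σ : ℝ) (p : EuclideanSpace ℂ (Fin n)) (i : Fin n) :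
    Differentiable ℂ (arc σ p i) :=
  (differentiable_slice p i).comp (by fun_prop)

theorem arc_zero (σ : ℝ) (p : EuclideanSpace ℂ (Fin n)) (i : Fin n) : arc σ p i 0 = p := by
  simp [arc, slice_self]

theorem exists_arc_mem (σ : ℝ) (i : Fin n) (hU : IsOpen U) (hpU : p ∈ U) :
    ∃ δ > 0, ∀ t : ℂ, ‖t‖ ≤ δ → arc σ p i t ∈ U := by
  have h : ∀ᶠ t in 𝓝 (0 : ℂ), arc σ p i t ∈ U :=
    (differentiable_arc σ p i).continuous.tendsto 0 (hU.mem_nhds (by rwa [arc_zero]))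
  obtain ⟨δ, hδ, h⟩ := nhds_basis_closedBall.mem_iff.1 h
  exact ⟨δ, hδ, fun t ht ↦ h (by simpa using ht)⟩

/-- The local inverse is `t = -σ i log (w / c)`, continuous and zero at `w = c`. It transfers
estimates in `t` to neighbourhoods in the slice. -/
theorem eventually_exists_coord_arc (hσ : σ * σ = 1) {c : ℂ} (hc : c ≠ 0) {δ : ℝ} (hδ : 0 < δ) :
    ∀ᶠ w in 𝓝 c, ∃ t : ℂ, ‖t‖ ≤ δ ∧ w = c * Complex.exp (σ * Complex.I * t) := by
  have hcont : ContinuousAt (fun w : ℂ ↦ -(σ * Complex.I * Complex.log (w / c))) c := by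
    have h1 : ContinuousAt Complex.log (c / c) :=
      continuousAt_clog (by rw [div_self hc]; exact Complex.one_mem_slitPlane)
    have h2 : ContinuousAt (fun w : ℂ ↦ Complex.log (w / c)) c :=
      ContinuousAt.comp (f := fun w : ℂ ↦ w / c) h1 (continuousAt_id.div_const c)
    exact (continuousAt_const.mul h2).neg
  have hlim := hcont.tendsto
  rw [div_self hc, Complex.log_one, mul_zero, neg_zero] at hlim
  filter_upwards [hlim (closedBall_mem_nhds 0 hδ), isOpen_ne.mem_nhds hc] with w hw hw0
  refine ⟨_, mem_closedBall_zero_iff.1 hw, ?_⟩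
  have hσ' : (σ : ℂ) * σ = 1 := by exact_mod_cast hσ
  have : (σ : ℂ) * Complex.I * -(σ * Complex.I * Complex.log (w / c)) = Complex.log (w / c) := by
    linear_combination (-(σ : ℂ) * σ * Complex.log (w / c)) * Complex.I_mul_I +
      Complex.log (w / c) * hσ'
  rw [this, Complex.exp_log (div_ne_zero hw0 hc)]
  field_simp

section HalfDisc

variable {F : EuclideanSpace ℂ (Fin n) → ℂ} {δ : ℝ}

theorem arc_mem_extDomain (hΩ : IsSide σ Ω) (hp : p ∈ USphere n) (hpi : p i ≠ 0)
    (hδ : ∀ t : ℂ, ‖t‖ ≤ δ → arc σ p i t ∈ U) {t : ℂ} (ht : ‖t‖ ≤ δ) (htim : 0 ≤ t.im) :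
    arc σ p i t ∈ extDomain Ω U := by
  rcases htim.eq_or_lt with h | h
  · exact Or.inr (arc_mem_sphere hp h.symm)
  · exact Or.inl ⟨hδ t ht, (arc_mem_side hΩ hp hpi).2 h⟩

theorem continuousOn_comp_arc (hΩ : IsSide σ Ω) (hp : p ∈ USphere n) (hpi : p i ≠ 0)
    (hδ : ∀ t : ℂ, ‖t‖ ≤ δ → arc σ p i t ∈ U)
    (hF : SeparatelyContinuousOn F (extDomain Ω U)) :
    ContinuousOn (fun t ↦ F (arc σ p i t)) {t | ‖t‖ ≤ δ ∧ 0 ≤ t.im} := by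
  have h := hF p (Or.inr hp) i
  exact h.comp (f := fun t : ℂ ↦ p i * Complex.exp (σ * Complex.I * t))
    (Continuous.continuousOn (by fun_prop))
    fun t ht ↦ arc_mem_extDomain hΩ hp hpi hδ ht.1 ht.2

theorem differentiableOn_comp_arc (hΩ : IsSide σ Ω) (hp : p ∈ USphere n) (hpi : p i ≠ 0)
    (hδ : ∀ t : ℂ, ‖t‖ ≤ δ → arc σ p i t ∈ U) (hF : DifferentiableOn ℂ F (U ∩ Ω)) :
    DifferentiableOn ℂ (fun t ↦ F (arc σ p i t)) {t | ‖t‖ < δ ∧ 0 < t.im} :=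
  hF.comp (differentiable_arc σ p i).differentiableOn
    fun t ht ↦ ⟨hδ t ht.1.le, (arc_mem_side hΩ hp hpi).2 ht.2⟩

end HalfDisc

/-- `f` has a holomorphic extension to `U ∩ Ω`, bounded by `M` and separately continuous. -/
def SepExtendableOn (Ω U : Set (EuclideanSpace ℂ (Fin n))) (M : ℝ) (f : C(USphere n, ℂ)) : Prop :=
  ∃ F : EuclideanSpace ℂ (Fin n) → ℂ, IsHolomorphicExtension Ω U F f ∧
    (∀ z ∈ extDomain Ω U, ‖F z‖ ≤ M) ∧ SeparatelyContinuousOn F (extDomain Ω U)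

theorem extDomain_mono {U V : Set (EuclideanSpace ℂ (Fin n))} (h : V ⊆ U) :
    extDomain Ω V ⊆ extDomain Ω U :=
  union_subset_union_left _ (inter_subset_inter_left _ h)

theorem IsHolomorphicExtension.mono {U V : Set (EuclideanSpace ℂ (Fin n))} (h : V ⊆ U)
    {F : EuclideanSpace ℂ (Fin n) → ℂ} {f : C(USphere n, ℂ)}
    (hF : IsHolomorphicExtension Ω U F f) : IsHolomorphicExtension Ω V F f :=
  ⟨hF.1.mono (inter_subset_inter_left _ h), hF.2⟩

theorem SeparatelyContinuousOn.mono {A B : Set (EuclideanSpace ℂ (Fin n))} (h : B ⊆ A)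
    {F : EuclideanSpace ℂ (Fin n) → ℂ} (hF : SeparatelyContinuousOn F A) :
    SeparatelyContinuousOn F B :=
  fun z hz i ↦ (hF z (h hz) i).mono fun _ hw ↦ h hw

theorem _root_.ContinuousOn.separatelyContinuousOn {A : Set (EuclideanSpace ℂ (Fin n))}
    {F : EuclideanSpace ℂ (Fin n) → ℂ} (hF : ContinuousOn F A) : SeparatelyContinuousOn F A :=
  fun z _ i ↦ hF.comp (differentiable_slice z i).continuous.continuousOn fun _ hw ↦ hw

theorem SepExtendableOn.mono {U V : Set (EuclideanSpace ℂ (Fin n))} (h : V ⊆ U) {M N : ℝ}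
    (hMN : M ≤ N) {f : C(USphere n, ℂ)} (hf : SepExtendableOn Ω U M f) :
    SepExtendableOn Ω V N f := by
  obtain ⟨F, h1, h2, h3⟩ := hf
  exact ⟨F, h1.mono h, fun z hz ↦ (h2 z (extDomain_mono h hz)).trans hMN,
    h3.mono (extDomain_mono h)⟩

theorem sepExtendableAt_iff {f : C(USphere n, ℂ)} {ζ : USphere n} :
    SepExtendableAt Ω f ζ ↔
      ∃ U, IsOpen U ∧ (ζ : EuclideanSpace ℂ (Fin n)) ∈ U ∧ ∃ M, SepExtendableOn Ω U M f := by
  constructor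
  · rintro ⟨U, h1, h2, F, h3, ⟨M, h4⟩, h5⟩
    exact ⟨U, h1, h2, M, F, h3, h4, h5⟩
  · rintro ⟨U, h1, h2, M, F, h3, h4, h5⟩
    exact ⟨U, h1, h2, F, h3, ⟨M, h4⟩, h5⟩

/-- A separately continuous extension of the coordinate function `max 0 (σ Im (zᵢ / pᵢ))` would
vanish on one side of `p` in the `i`-th slice, hence on both. -/
theorem exists_not_sepExtendableOn (hΩ : IsSide σ Ω) (hU : IsOpen U) (hp : p ∈ USphere n)
    (hpU : p ∈ U) : ∃ f : C(USphere n, ℂ), ∀ M, ¬ SepExtendableOn Ω U M f := by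
  obtain ⟨i, hpi⟩ : ∃ i, p i ≠ 0 := by
    by_contra! h
    have : p = 0 := by ext i; exact h i
    simp [this] at hp
  let f : C(USphere n, ℂ) :=
    ⟨fun z ↦ ((max 0 (σ * (z.1 i / p i).im) : ℝ) : ℂ), by
      refine Complex.continuous_ofReal.comp (continuous_const.max (continuous_const.mul
        (Complex.continuous_im.comp (Continuous.div_const ?_ _))))
      fun_prop⟩
  refine ⟨f, ?_⟩
  rintro M ⟨F, hF, -, hs⟩
  obtain ⟨δ₀, hδ₀, h₀⟩ := exists_arc_mem σ i hU hpU
  -- The cap at 1, below π, keeps the sign of `sin s` equal to that of `s` for `|s| ≤ δ`.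
  let δ := min δ₀ 1
  have hδ : 0 < δ := lt_min hδ₀ one_pos
  have hδU : ∀ t : ℂ, ‖t‖ ≤ δ → arc σ p i t ∈ U := fun t ht ↦ h₀ t (ht.trans (min_le_left _ _))
  have hval : ∀ s : ℝ, F (arc σ p i s) = ((max 0 (Real.sin s) : ℝ) : ℂ) := by
    intro s
    have hm : arc σ p i s ∈ USphere n := arc_mem_sphere hp (Complex.ofReal_im s)
    refine (hF.2 ⟨_, hm⟩).trans ?_
    have : (arc σ p i s) i / p i = Complex.exp ((σ * s : ℝ) * Complex.I) := by
      rw [arc, slice_apply, mul_div_cancel_left₀ _ hpi]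
      congr 1; push_cast; ring
    change ((max 0 (σ * ((arc σ p i s) i / p i).im) : ℝ) : ℂ) = _
    rw [this, Complex.exp_ofReal_mul_I_im]
    rcases hΩ with ⟨rfl, -⟩ | ⟨rfl, -⟩ <;> simp
  have hz := eq_zero_of_halfDisc hδ (continuousOn_comp_arc hΩ hp hpi hδU hs)
    (differentiableOn_comp_arc hΩ hp hpi hδU hF.1) (fun s hs hs0 ↦ ?_) (δ / 2)
    (by rw [abs_of_pos (by positivity)]; linarith)
  · rw [hval] at hz
    have h1 : 0 < Real.sin (δ / 2) := Real.sin_pos_of_pos_of_lt_pi (by positivity) (by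
      have := min_le_right δ₀ 1
      have := Real.pi_gt_three
      simp only [δ]; linarith)
    rw [Complex.ofReal_eq_zero, max_eq_right h1.le] at hz
    exact h1.ne' hz
  · have h1 : δ ≤ 1 := min_le_right _ _
    rw [abs_le] at hs
    rw [hval, max_eq_left, Complex.ofReal_zero]
    exact Real.sin_nonpos_of_nonpos_of_neg_pi_le hs0 (by linarith [Real.pi_gt_three])

end

/-! ### Limits of separately continuous extensions -/

section

variable {n : ℕ} {σ : ℝ} {Ω U : Set (EuclideanSpace ℂ (Fin n))} {p : EuclideanSpace ℂ (Fin n)}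
  {i : Fin n}

section Limit

variable {𝒰 : Ultrafilter C(USphere n, ℂ)} {f : C(USphere n, ℂ)} {M : ℝ}
  {F : C(USphere n, ℂ) → EuclideanSpace ℂ (Fin n) → ℂ} {G : EuclideanSpace ℂ (Fin n) → ℂ}

/-- Limits of extensions along an ultrafilter converging to `f`: holomorphy and boundary values. -/
theorem isHolomorphicExtension_of_tendsto (hΩ : IsOpen Ω) (hU : IsOpen U)
    (h𝒰 : (𝒰 : Filter C(USphere n, ℂ)) ≤ 𝓝 f)
    (hF : ∀ᶠ g in (𝒰 : Filter C(USphere n, ℂ)), IsHolomorphicExtension Ω U (F g) g)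
    (hM : ∀ᶠ g in (𝒰 : Filter C(USphere n, ℂ)), ∀ z ∈ extDomain Ω U, ‖F g z‖ ≤ M)
    (hG : ∀ z ∈ extDomain Ω U, Tendsto (fun g ↦ F g z) 𝒰 (𝓝 (G z))) :
    IsHolomorphicExtension Ω U G f := by
  refine ⟨differentiableOn_of_tendsto_ultrafilter 𝒰 (hU.inter hΩ) (hF.mono fun g h ↦ h.1)
    (hM.mono fun g h z hz ↦ h z (Or.inl hz)) fun z hz ↦ hG z (Or.inl hz), fun x ↦ ?_⟩
  refine tendsto_nhds_unique (hG x (Or.inr x.2)) ?_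
  have h1 : Tendsto (fun g : C(USphere n, ℂ) ↦ g x) 𝒰 (𝓝 (f x)) :=
    ((continuous_eval_const x).tendsto f).mono_left h𝒰
  refine h1.congr' ?_
  filter_upwards [hF] with g hg using (hg.2 x).symm

/-- Limits of extensions that are bounded and separately continuous along an ultrafilter converging
to `f` are separately continuous at the points of the sphere in `U`. -/
theorem continuousWithinAt_slice_of_tendsto (hΩ : IsSide σ Ω) (hU : IsOpen U)
    (h𝒰 : (𝒰 : Filter C(USphere n, ℂ)) ≤ 𝓝 f)
    (hF : ∀ᶠ g in (𝒰 : Filter C(USphere n, ℂ)), IsHolomorphicExtension Ω U (F g) g)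
    (hM : ∀ᶠ g in (𝒰 : Filter C(USphere n, ℂ)), ∀ z ∈ extDomain Ω U, ‖F g z‖ ≤ M)
    (hs : ∀ᶠ g in (𝒰 : Filter C(USphere n, ℂ)), SeparatelyContinuousOn (F g) (extDomain Ω U))
    (hG : ∀ z ∈ extDomain Ω U, Tendsto (fun g ↦ F g z) 𝒰 (𝓝 (G z)))
    (hp : p ∈ USphere n) (hpU : p ∈ U) (i : Fin n) :
    ContinuousWithinAt (fun w ↦ G (slice p i w)) {w | slice p i w ∈ extDomain Ω U} (p i) := by
  have hpS : p i ∈ {w | slice p i w ∈ extDomain Ω U} := by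
    rw [mem_ofPred_eq, slice_self]; exact Or.inr hp
  -- The logarithmic coordinate needs `p i ≠ 0`. If `p i = 0`, the inner domain meets the slice only
  -- in `p`, while on the outer side a punctured disc lies in `U ∩ Ω` and the singularity at its
  -- center is removable.
  by_cases hpi : p i = 0
  · rcases hΩ.imp id id with ⟨rfl, -⟩ | ⟨rfl, -⟩
    · refine continuousWithinAt_singleton.mono fun w hw ↦ ?_
      have h0 : ‖w‖ ≤ ‖p i‖ := by
        rcases hw with hw | hw
        · have := (slice_mem_side hΩ hp w).1 hw.2
          linarith
        · exact ((slice_mem_sphere hp w).1 hw).le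
      rw [hpi, norm_zero, norm_le_zero_iff] at h0
      rw [mem_singleton_iff, hpi, h0]
    · have hnhds : ∀ᶠ w in 𝓝 (0 : ℂ), slice p i w ∈ U :=
        (differentiable_slice p i).continuous.tendsto 0
          (hU.mem_nhds (by rwa [← hpi, slice_self]))
      obtain ⟨δ, hδ, hδU⟩ := nhds_basis_ball.mem_iff.1 hnhds
      have hside : ∀ w ∈ ball (0 : ℂ) δ \ {0}, slice p i w ∈ U ∩ Ω := by
        intro w hw
        refine ⟨hδU hw.1, (slice_mem_side hΩ hp w).2 ?_⟩
        have : 0 < ‖w‖ := norm_pos_iff.2 hw.2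
        rw [hpi, norm_zero]; linarith
      have hdom : ∀ w ∈ ball (0 : ℂ) δ, slice p i w ∈ extDomain Ω U := by
        intro w hw
        by_cases hw0 : w = 0
        · rw [hw0, ← hpi]; exact hpS
        · exact Or.inl (hside w ⟨hw, hw0⟩)
      have hd : DifferentiableOn ℂ (fun w ↦ G (slice p i w)) (ball 0 δ) := by
        refine differentiableOn_of_tendsto_ultrafilter (F := fun g w ↦ F g (slice p i w)) 𝒰
          isOpen_ball (M := M) ?_ (hM.mono fun g h w hw ↦ h _ (hdom w hw))
          fun w hw ↦ hG _ (hdom w hw)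
        filter_upwards [hF, hs] with g hFg hsg
        rw [← Complex.differentiableOn_compl_singleton_and_continuousAt_iff
          (ball_mem_nhds (0 : ℂ) hδ)]
        refine ⟨hFg.1.comp (differentiable_slice p i).differentiableOn hside, ?_⟩
        refine ((hsg p (Or.inr hp) i).mono hdom).continuousAt (ball_mem_nhds 0 hδ)
      rw [hpi]
      exact (hd.differentiableAt (ball_mem_nhds 0 hδ)).continuousAt.continuousWithinAt
  · obtain ⟨δ, hδ, hδU⟩ := exists_arc_mem σ i hU hpU
    refine continuousWithinAt_of_locally_uniform_approx_of_continuousWithinAt hpS fun u hu ↦ ?_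
    obtain ⟨η, hη, hηu⟩ := Metric.mem_uniformity_dist.1 hu
    have hclose := eventually_norm_sub_le_of_halfDisc (M := M) (h := fun g t ↦ F g (arc σ p i t))
      (H := fun t ↦ G (arc σ p i t)) 𝒰 hδ
      (hs.mono fun g h ↦ continuousOn_comp_arc hΩ hp hpi hδU h)
      (hF.mono fun g h ↦ differentiableOn_comp_arc hΩ hp hpi hδU h.1)
      (hM.mono fun g h t ht htim ↦ h _ (arc_mem_extDomain hΩ hp hpi hδU ht htim))
      (fun ε hε ↦ by
        -- Real parameters land on the sphere, where extensions equal their boundary functions, so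
        -- sup-norm convergence makes them uniformly Cauchy.
        have hball : ∀ᶠ g in (𝒰 : Filter C(USphere n, ℂ)), dist g f < ε / 2 :=
          h𝒰 (ball_mem_nhds f (half_pos hε))
        filter_upwards [hF, hball] with g hFg hg
        filter_upwards [hF, hball] with g' hFg' hg' t _ htim
        have hm : arc σ p i t ∈ USphere n := arc_mem_sphere hp htim
        have e1 := hFg.2 ⟨_, hm⟩
        have e2 := hFg'.2 ⟨_, hm⟩
        simp only at e1 e2
        rw [e1, e2, ← dist_eq_norm]
        refine (ContinuousMap.dist_apply_le_dist _).trans ((dist_triangle_right _ _ f).trans ?_)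
        linarith)
      (fun t ht htim ↦ hG _ (arc_mem_extDomain hΩ hp hpi hδU ht htim)) (half_pos hη)
    obtain ⟨g, hg, hsg⟩ := (hclose.and hs).exists
    refine ⟨{w | slice p i w ∈ extDomain Ω U ∧
        ∃ t : ℂ, ‖t‖ ≤ δ / 16 ∧ w = p i * Complex.exp (σ * Complex.I * t)}, ?_,
      fun w ↦ F g (slice p i w), hsg p (Or.inr hp) i _ hpS, ?_⟩
    · exact inter_mem self_mem_nhdsWithin (mem_nhdsWithin_of_mem_nhds
        (eventually_exists_coord_arc hΩ.sq hpi (by positivity)))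
    · rintro w ⟨hw, t, ht, rfl⟩
      refine hηu ?_
      rw [dist_comm, dist_eq_norm]
      exact (hg t ht (im_nonneg_of_arc_mem hΩ hp hpi hw)).trans_lt (half_lt_self hη)

end Limit

/-- Shrinking the ball handles its rim: sphere points inside the larger ball have room for a half
disc, and near the others the smaller domain is just the sphere, where the limit is `f`. -/
theorem sepExtendableOn_of_mem_closure (hΩ : IsSide σ Ω) {ζ : EuclideanSpace ℂ (Fin n)} {r s M : ℝ}
    (hsr : s < r) {f : C(USphere n, ℂ)}
    (hf : f ∈ closure {g | SepExtendableOn Ω (ball ζ r) M g}) :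
    SepExtendableOn Ω (ball ζ s) M f := by
  obtain ⟨𝒰, hS, h𝒰⟩ := mem_closure_iff_ultrafilter.1 hf
  have hS' : ∀ g ∈ {g | SepExtendableOn Ω (ball ζ r) M g}, SepExtendableOn Ω (ball ζ r) M g :=
    fun g hg ↦ hg
  unfold SepExtendableOn at hS'
  choose! F hF using hS'
  have hF1 : ∀ᶠ g in (𝒰 : Filter C(USphere n, ℂ)), IsHolomorphicExtension Ω (ball ζ r) (F g) g :=
    mem_of_superset hS fun g hg ↦ (hF g hg).1
  have hF2 : ∀ᶠ g in (𝒰 : Filter C(USphere n, ℂ)), ∀ z ∈ extDomain Ω (ball ζ r), ‖F g z‖ ≤ M :=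
    mem_of_superset hS fun g hg ↦ (hF g hg).2.1
  have hF3 : ∀ᶠ g in (𝒰 : Filter C(USphere n, ℂ)),
      SeparatelyContinuousOn (F g) (extDomain Ω (ball ζ r)) :=
    mem_of_superset hS fun g hg ↦ (hF g hg).2.2
  have hlim : ∀ z ∈ extDomain Ω (ball ζ r), ∃ y : ℂ, ‖y‖ ≤ M ∧
      Tendsto (fun g ↦ F g z) 𝒰 (𝓝 y) := by
    intro z hz
    obtain ⟨y, hy, h⟩ := (isCompact_closedBall (0 : ℂ) M).ultrafilter_le_nhds
      (𝒰.map fun g ↦ F g z)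
      (le_principal_iff.2 (hF2.mono fun g h ↦ mem_closedBall_zero_iff.2 (h z hz)))
    exact ⟨y, mem_closedBall_zero_iff.1 hy, h⟩
  choose! G hGM hG using hlim
  have hhol := isHolomorphicExtension_of_tendsto hΩ.isOpen isOpen_ball h𝒰 hF1 hF2 hG
  have hsub : ball ζ s ⊆ ball ζ r := ball_subset_ball hsr.le
  refine ⟨G, hhol.mono hsub, fun z hz ↦ hGM z (extDomain_mono hsub hz), ?_⟩
  intro z hz i w hw
  set q := slice z i w with hq
  have hw : q ∈ extDomain Ω (ball ζ s) := hw
  have hqi : q i = w := slice_apply z i w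
  have hslice : ∀ w', WithLp.toLp 2 (Function.update z.ofLp i w') = slice q i w' :=
    fun w' ↦ (slice_slice z i w w').symm
  simp only [hslice]
  rw [← hqi]
  rcases hw with hw | hw
  · have hd : DifferentiableAt ℂ G q := hhol.1.differentiableAt
      ((isOpen_ball.inter hΩ.isOpen).mem_nhds ⟨hsub hw.1, hw.2⟩)
    rw [← slice_self q i] at hd
    exact (ContinuousAt.comp hd.continuousAt
      (differentiable_slice q i).continuous.continuousAt).continuousWithinAt
  · by_cases hqU : q ∈ ball ζ r
    · exact (continuousWithinAt_slice_of_tendsto hΩ isOpen_ball h𝒰 hF1 hF2 hF3 hG hw hqU i).mono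
        fun w' hw' ↦ extDomain_mono hsub hw'
    · have hGS : ContinuousOn G (USphere n) := by
        rw [continuousOn_iff_continuous_domRestrict]
        exact f.continuous.congr fun x ↦ (hhol.2 x).symm
      have hc : ContinuousWithinAt (fun w' ↦ G (slice q i w'))
          {w' | slice q i w' ∈ USphere n} (q i) :=
        (hGS.comp (differentiable_slice q i).continuous.continuousOn fun _ h ↦ h) (q i)
          (show slice q i (q i) ∈ USphere n by rwa [slice_self])
      refine hc.mono_of_mem_nhdsWithin ?_
      have hne : q ∈ (closedBall ζ s)ᶜ := fun h ↦ hqU (closedBall_subset_ball hsr h)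
      have hev : ∀ᶠ w' in 𝓝 (q i), slice q i w' ∈ (closedBall ζ s)ᶜ :=
        (differentiable_slice q i).continuous.tendsto (q i)
          (isClosed_closedBall.isOpen_compl.mem_nhds (by rwa [slice_self]))
      filter_upwards [mem_nhdsWithin_of_mem_nhds hev, self_mem_nhdsWithin] with w' h1 h2
      rcases h2 with h2 | h2
      · exact absurd (ball_subset_closedBall h2.1) h1
      · exact h2

/-! ### Baire category in the separately continuous case -/

theorem SepExtendableOn.add {M N : ℝ} {f g : C(USphere n, ℂ)} (hf : SepExtendableOn Ω U M f)
    (hg : SepExtendableOn Ω U N g) : SepExtendableOn Ω U (M + N) (f + g) := by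
  obtain ⟨F, hF, hFM, hFs⟩ := hf
  obtain ⟨G, hG, hGN, hGs⟩ := hg
  refine ⟨F + G, ⟨hF.1.add hG.1, fun x ↦ ?_⟩, fun z hz ↦ ?_, fun z hz i ↦ ?_⟩
  · simp [hF.2 x, hG.2 x]
  · exact (norm_add_le _ _).trans (add_le_add (hFM z hz) (hGN z hz))
  · exact (hFs z hz i).add (hGs z hz i)

theorem SepExtendableOn.smul {M : ℝ} (c : ℂ) {f : C(USphere n, ℂ)}
    (hf : SepExtendableOn Ω U M f) : SepExtendableOn Ω U (‖c‖ * M) (c • f) := by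
  obtain ⟨F, hF, hFM, hFs⟩ := hf
  refine ⟨c • F, ⟨hF.1.const_smul c, fun x ↦ ?_⟩, fun z hz ↦ ?_, fun z hz i ↦ ?_⟩
  · simp [hF.2 x]
  · rw [Pi.smul_apply, norm_smul]
    exact mul_le_mul_of_nonneg_left (hFM z hz) (norm_nonneg c)
  · exact (hFs z hz i).const_smul c

/-- The subspace of all functions with a bounded separately continuous extension to `U ∩ Ω`. -/
def sepExtendableSubmodule (Ω U : Set (EuclideanSpace ℂ (Fin n))) :
    Submodule ℂ C(USphere n, ℂ) where
  carrier := {f | ∃ M, SepExtendableOn Ω U M f}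
  zero_mem' := ⟨0, 0, ⟨differentiableOn_const 0, fun _ ↦ rfl⟩, fun _ _ ↦ by simp,
    fun _ _ _ ↦ continuousOn_const⟩
  add_mem' := fun ⟨M, hf⟩ ⟨N, hg⟩ ↦ ⟨M + N, hf.add hg⟩
  smul_mem' := fun c _ ⟨M, hf⟩ ↦ ⟨‖c‖ * M, hf.smul c⟩

theorem dense_compl_closure_sepExtendableOn (hΩ : IsSide σ Ω) {ζ : EuclideanSpace ℂ (Fin n)}
    (hζ : ζ ∈ USphere n) {r : ℝ} (hr : 0 < r) (M : ℝ) :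
    Dense (closure {g | SepExtendableOn Ω (ball ζ r) M g})ᶜ := by
  rw [← interior_eq_empty_iff_dense_compl, ← not_nonempty_iff_eq_empty]
  intro hne
  have hsub : closure {g | SepExtendableOn Ω (ball ζ r) M g} ⊆
      (sepExtendableSubmodule Ω (ball ζ (r / 2)) : Set C(USphere n, ℂ)) :=
    fun f hf ↦ ⟨M, sepExtendableOn_of_mem_closure hΩ (half_lt_self hr) hf⟩
  -- The bound `M` is dropped here because only the union over all bounds is a linear subspace.
  have htop := Submodule.eq_top_of_nonempty_interior' (R := ℂ) _
    (hne.mono (interior_mono hsub))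
  obtain ⟨f, hf⟩ := exists_not_sepExtendableOn hΩ isOpen_ball hζ
    (mem_ball_self (half_pos hr) : ζ ∈ ball ζ (r / 2))
  have hmem : f ∈ sepExtendableSubmodule Ω (ball ζ (r / 2)) := htop ▸ Submodule.mem_top
  obtain ⟨M', hM'⟩ := hmem
  exact hf M' hM'

/-- Balls with centers in a countable dense subset of the sphere and radii `1 / (m + 1)` suffice to
test a local property. -/
theorem exists_ball_subset {D : Set (USphere n)} (hD : Dense D) (hU : IsOpen U) {ζ : USphere n}
    (hζ : (ζ : EuclideanSpace ℂ (Fin n)) ∈ U) :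
    ∃ x ∈ D, ∃ m : ℕ, ball x.1 (1 / (m + 1 : ℝ)) ⊆ U := by
  obtain ⟨r, hr, hrU⟩ := Metric.isOpen_iff.1 hU ζ hζ
  obtain ⟨m, hm⟩ := exists_nat_one_div_lt (half_pos hr)
  have hpos : 0 < 1 / (m + 1 : ℝ) := Nat.one_div_pos_of_nat
  obtain ⟨x, hxD, hx⟩ := hD.exists_dist_lt ζ hpos
  have hx : dist ζ.1 x.1 < 1 / (m + 1 : ℝ) := hx
  refine ⟨x, hxD, m, fun z hz ↦ hrU ?_⟩
  rw [mem_ball] at hz ⊢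
  have := dist_triangle_right z ζ.1 x.1
  linarith

/-- Taking closures costs nothing: a function in one of them is still extendable at the center of
the ball, over half the radius. -/
theorem nowhereSepExtendable_eq_iInter (hΩ : IsSide σ Ω) {D : Set (USphere n)} (hD : Dense D) :
    nowhereSepExtendable Ω = ⋂ k : D × ℕ × ℕ,
      (closure {g | SepExtendableOn Ω (ball k.1.1.1 (1 / (k.2.1 + 1 : ℝ))) k.2.2 g})ᶜ := by
  ext f
  simp only [nowhereSepExtendable, mem_ofPred_eq, mem_iInter, mem_compl_iff]
  constructor
  · rintro h ⟨x, m, M⟩ hf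
    have hpos : 0 < 1 / (m + 1 : ℝ) := Nat.one_div_pos_of_nat
    exact h x.1 (sepExtendableAt_iff.2 ⟨_, isOpen_ball, mem_ball_self (half_pos hpos), M,
      sepExtendableOn_of_mem_closure hΩ (half_lt_self hpos) hf⟩)
  · intro h ζ hf
    obtain ⟨U, hU, hζ, M, hf⟩ := sepExtendableAt_iff.1 hf
    obtain ⟨x, hx, m, hmU⟩ := exists_ball_subset hD hU hζ
    obtain ⟨N, hN⟩ := exists_nat_ge M
    exact h ⟨⟨x, hx⟩, m, N⟩ (subset_closure (hf.mono hmU hN))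

theorem isGδ_nowhereSepExtendable (hΩ : IsSide σ Ω) : IsGδ (nowhereSepExtendable Ω) := by
  obtain ⟨D, hDc, hD⟩ := TopologicalSpace.exists_countable_dense (USphere n)
  have := hDc.to_subtype
  rw [nowhereSepExtendable_eq_iInter hΩ hD]
  exact .iInter_of_isOpen fun k ↦ isClosed_closure.isOpen_compl

theorem dense_nowhereSepExtendable (hΩ : IsSide σ Ω) : Dense (nowhereSepExtendable Ω) := by
  obtain ⟨D, hDc, hD⟩ := TopologicalSpace.exists_countable_dense (USphere n)
  have := hDc.to_subtype
  rw [nowhereSepExtendable_eq_iInter hΩ hD]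
  exact dense_iInter_of_isOpen (fun k ↦ isClosed_closure.isOpen_compl) fun k ↦
    dense_compl_closure_sepExtendableOn hΩ k.1.1.2 Nat.one_div_pos_of_nat _

/-! ### Continuous and Lipschitz extensions -/

theorem ExtendableAt.sepExtendableAt (hΩ : IsSide σ Ω) {f : C(USphere n, ℂ)} {ζ : USphere n}
    (h : ExtendableAt Ω f ζ) : SepExtendableAt Ω f ζ := by
  obtain ⟨U, hU, hζ, F, hF, hc⟩ := h
  obtain ⟨r, hr, hrU⟩ := nhds_basis_closedBall.mem_iff.1 (hU.mem_nhds hζ)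
  have hbU : ball ζ.1 r ⊆ U := ball_subset_closedBall.trans hrU
  -- Boundedness comes from this compact set, which contains the shrunken domain and lies in the
  -- original one.
  have hK : IsCompact (closedBall ζ.1 r ∩ (Ω ∪ USphere n) ∪ USphere n) :=
    ((isCompact_closedBall ζ.1 r).inter_right hΩ.isClosed_union).union (isCompact_sphere 0 1)
  obtain ⟨M, hM⟩ := hK.exists_bound_of_continuousOn (hc.mono (by
    rintro z (⟨h1, h2 | h2⟩ | h2)
    exacts [Or.inl ⟨hrU h1, h2⟩, Or.inr h2, Or.inr h2]))
  refine ⟨ball ζ.1 r, isOpen_ball, mem_ball_self hr, F, hF.mono hbU, ⟨M, fun z hz ↦ hM z ?_⟩,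
    (hc.mono (extDomain_mono hbU)).separatelyContinuousOn⟩
  rcases hz with hz | hz
  · exact Or.inl ⟨ball_subset_closedBall hz.1, Or.inl hz.2⟩
  · exact Or.inr hz

theorem LipExtendableAt.extendableAt {f : C(USphere n, ℂ)} {ζ : USphere n}
    (h : LipExtendableAt Ω f ζ) : ExtendableAt Ω f ζ := by
  obtain ⟨U, hU, hζ, F, hF, K, hK⟩ := h
  exact ⟨U, hU, hζ, F, hF, hK.continuousOn⟩

/-- The Lipschitz inequality is a pointwise condition, so it passes to the limit on the same ball;
unlike the separately continuous case, no shrinking is needed. -/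
theorem isClosed_setOf_lipExtension (hΩ : IsOpen Ω) (ζ : USphere n) (r : ℝ) (K : NNReal) :
    IsClosed {f : C(USphere n, ℂ) | ∃ F, IsHolomorphicExtension Ω (ball ζ.1 r) F f ∧
      LipschitzOnWith K F (extDomain Ω (ball ζ.1 r))} := by
  refine isClosed_iff_ultrafilter.2 fun f 𝒰 h𝒰 hS ↦ ?_
  let A := extDomain Ω (ball ζ.1 r)
  have hS' : ∀ g ∈ {f : C(USphere n, ℂ) | ∃ F, IsHolomorphicExtension Ω (ball ζ.1 r) F f ∧
      LipschitzOnWith K F A}, ∃ F, IsHolomorphicExtension Ω (ball ζ.1 r) F g ∧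
      LipschitzOnWith K F A := fun g hg ↦ hg
  choose! F hF using hS'
  have hF1 : ∀ᶠ g in (𝒰 : Filter C(USphere n, ℂ)),
      IsHolomorphicExtension Ω (ball ζ.1 r) (F g) g :=
    mem_of_superset hS fun g hg ↦ (hF g hg).1
  have hF2 : ∀ᶠ g in (𝒰 : Filter C(USphere n, ℂ)), LipschitzOnWith K (F g) A :=
    mem_of_superset hS fun g hg ↦ (hF g hg).2
  have hζA : ζ.1 ∈ A := Or.inr ζ.2
  have hζ1 : ‖ζ.1‖ = 1 := mem_sphere_zero_iff_norm.1 ζ.2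
  -- At `ζ` the extension of `g` has modulus at most `‖f‖ + 1` once `dist g f < 1`, and every point
  -- of the domain is within `|r| + 2` of `ζ`.
  let M := ‖f‖ + 1 + K * (|r| + 2)
  have hball : ∀ᶠ g in (𝒰 : Filter C(USphere n, ℂ)), dist g f < 1 :=
    h𝒰 (ball_mem_nhds f one_pos)
  have hM : ∀ᶠ g in (𝒰 : Filter C(USphere n, ℂ)), ∀ z ∈ A, ‖F g z‖ ≤ M := by
    filter_upwards [hF1, hF2, hball] with g h1 h2 h3 z hz
    have hdist : dist z ζ.1 ≤ |r| + 2 := by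
      rcases hz with hz | hz
      · have := mem_ball.1 hz.1
        linarith [le_abs_self r]
      · have := norm_sub_le z ζ.1
        rw [← dist_eq_norm, mem_sphere_zero_iff_norm.1 hz, hζ1] at this
        linarith [abs_nonneg r]
    have h4 : dist (F g z) (F g ζ.1) ≤ K * (|r| + 2) :=
      (h2.dist_le_mul z hz ζ.1 hζA).trans (by gcongr)
    have h5 : ‖F g ζ.1‖ ≤ ‖f‖ + 1 := by
      rw [h1.2 ζ]
      refine (g.norm_coe_le_norm ζ).trans ?_
      have := norm_sub_norm_le g f
      rw [← dist_eq_norm] at this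
      linarith
    have h6 := norm_sub_norm_le (F g z) (F g ζ.1)
    rw [← dist_eq_norm] at h6
    simp only [M]; linarith
  have hlim : ∀ z ∈ A, ∃ y : ℂ, Tendsto (fun g ↦ F g z) 𝒰 (𝓝 y) := by
    intro z hz
    obtain ⟨y, -, h⟩ := (isCompact_closedBall (0 : ℂ) M).ultrafilter_le_nhds
      (𝒰.map fun g ↦ F g z)
      (le_principal_iff.2 (hM.mono fun g h ↦ mem_closedBall_zero_iff.2 (h z hz)))
    exact ⟨y, h⟩
  choose! G hG using hlim
  refine ⟨G, isHolomorphicExtension_of_tendsto hΩ isOpen_ball h𝒰 hF1 hM hG,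
    LipschitzOnWith.of_dist_le_mul fun x hx y hy ↦ ?_⟩
  exact le_of_tendsto ((hG x hx).dist (hG y hy)) (hF2.mono fun g h ↦ h.dist_le_mul x hx y hy)

theorem isGδ_nowhereLipExtendable (hΩ : IsOpen Ω) : IsGδ (nowhereLipExtendable Ω) := by
  obtain ⟨D, hDc, hD⟩ := TopologicalSpace.exists_countable_dense (USphere n)
  have := hDc.to_subtype
  have heq : nowhereLipExtendable Ω = ⋂ k : D × ℕ × ℕ,
      {f : C(USphere n, ℂ) | ∃ F,
        IsHolomorphicExtension Ω (ball k.1.1.1 (1 / (k.2.1 + 1 : ℝ))) F f ∧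
        LipschitzOnWith k.2.2 F (extDomain Ω (ball k.1.1.1 (1 / (k.2.1 + 1 : ℝ))))}ᶜ := by
    ext f
    simp only [nowhereLipExtendable, mem_ofPred_eq, mem_iInter, mem_compl_iff]
    constructor
    · rintro h ⟨x, m, K⟩ ⟨F, h1, h2⟩
      exact h x.1 ⟨_, isOpen_ball, mem_ball_self Nat.one_div_pos_of_nat, F, h1, _, h2⟩
    · rintro h ζ ⟨U, hU, hζ, F, h1, K, h2⟩
      obtain ⟨x, hx, m, hmU⟩ := exists_ball_subset hD hU hζ
      obtain ⟨N, hN⟩ := exists_nat_ge K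
      exact h ⟨⟨x, hx⟩, m, N⟩ ⟨F, h1.mono hmU, (h2.mono (extDomain_mono hmU)).weaken hN⟩
  rw [heq]
  exact .iInter_of_isOpen fun k ↦ (isClosed_setOf_lipExtension hΩ _ _ _).isOpen_compl

end

end OneSidedSphere

theorem mainTheorem12 (n : ℕ) (hn : 1 ≤ n) (Ω : Set (EuclideanSpace ℂ (Fin n)))
    (hΩ : Ω = OneSidedSphere.innerSide n ∨ Ω = OneSidedSphere.outerSide n) :
    (IsGδ (OneSidedSphere.nowhereSepExtendable Ω) ∧
      Dense (OneSidedSphere.nowhereSepExtendable Ω)) ∧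
    OneSidedSphere.nowhereExtendable Ω ∈ residual C(OneSidedSphere.USphere n, ℂ) ∧
    (IsGδ (OneSidedSphere.nowhereLipExtendable Ω) ∧
      Dense (OneSidedSphere.nowhereLipExtendable Ω)) := by
  obtain ⟨σ, h⟩ : ∃ σ, OneSidedSphere.IsSide σ Ω := by
    rcases hΩ with h | h
    · exact ⟨1, Or.inl ⟨rfl, h⟩⟩
    · exact ⟨-1, Or.inr ⟨rfl, h⟩⟩
  have hG := OneSidedSphere.isGδ_nowhereSepExtendable h
  have hd := OneSidedSphere.dense_nowhereSepExtendable h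
  refine ⟨⟨hG, hd⟩, Filter.mem_of_superset (residual_of_dense_Gδ hG hd) ?_,
    OneSidedSphere.isGδ_nowhereLipExtendable h.isOpen, hd.mono ?_⟩
  · intro f hf ζ he
    exact hf ζ (he.sepExtendableAt h)
  · intro f hf ζ he
    exact hf ζ (he.extendableAt.sepExtendableAt h)
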